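/- **Setting.** Let $\Omega\subset\mathbb R^d$ be open and bounded with $\mathscr L^d(\partial\Omega)=0$, let $Z=\mathbb R^d/\mathbb Z^d$ be the flat torus (with its normalized Lebesgue measure $d\xi$), and let $E$ be a finite-dimensional Euclidean space with open unit ball $\mathbb B_E$ and unit sphere $\partial\mathbb B_E$. For $f:\Omega\times Z\times E\to\mathbb R$ put $(Tf)(x,\xi,\hat z)=(1-|\hat z|)\,f\big(x,\xi,\tfrac{\hat z}{1-|\hat z|}\big)$ on $\Omega\times Z\times\mathbb B_E$. Let $\mathbf E^2(\Omega;E)$ be the space of continuous $f$ for which $Tf$ extends continuously to $\overline{\Omega\times Z\times\mathbb B_E}$, with the norm $\|f\|=\|Tf\|_\infty$, and for $f$ in it let $$f^\infty(x,\xi,z)=\lim_{x'\to x,\ \xi'\to\xi,\ t\to\infty} \frac{f(x',\xi',tz)}{t}$$ (the limit over $x'\in\Omega$, $\xi'\in Z$, $t>0$), for $(x,\xi,z)\in\overline\Omega\times Z\times\partial\mathbb B_E$. A *two-scale\* Young measure* is a four-tuple $\boldsymbol\nu=(\nu,\lambda,\rho,\nu^\infty)$ where $\lambda$ is a bounded positive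 measure on $\overline\Omega$; $\rho:x\mapsto\rho_x$ is a weak-$*$ $\lambda$-measurable map from $\overline\Omega$ to the probability measures on $Z$; $\nu:(x,\xi)\mapsto\nu_{x,\xi}$ is a weak-$*$ (Lebesgue) measurable map from $\overline\Omega\times Z$ to the probability measures on $E$ such that $(x,\xi)\mapsto\langle|\cdot|,\nu_{x,\xi}\rangle$ is integrable; and $\nu^\infty$ is a weak-$*$ $(\lambda\otimes\rho_x)$-measurable map from $\overline\Omega\times Z$ to the probability measures on $\partial\mathbb B_E$. (A measure-valued map $\kappa$ is weak-$*$ $\mu$-measurable if $x\mapsto\kappa_x(B)$ is $\mu$-measurable for every Borel set $B$.) The set $\mathbf Y^2(\Omega;E)$ of all of them is regarded as a subset of the dual $\mathbf E^2(\Omega;E)^*$ through the pairing $$\langle\langle f,\boldsymbol\nu\rangle\rangle=\int_\Omega\int_Z\langle f(x,\xi,\cdot),\nu_{x,\xi}\rangle\,d\xi\,dx+\int_{\overline\Omega}\int_Z\langle f^\infty(x,\xi,\cdot),\nu^\infty_{x,\xi}\rangle\,d\rho_x(\xi)\,d\lambda(x).$$ **Proposition (compactness of two-scale\* Young measures).**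 The set $\mathbf Y^2(\Omega;E)$ is sequentially weak-$*$ closed in $\mathbf E^2(\Omega;E)^*$. Moreover, each subset $\mathcal Y\subset\mathbf Y^2(\Omega;E)$ with $$\sup\Big\{\int_{\overline\Omega}\int_Z\langle1+|\cdot|,\nu_{x,\xi}\rangle\,d\xi\,dx+\lambda(\overline\Omega)\ :\ \boldsymbol\nu=(\nu,\lambda,\rho,\nu^\infty)\in\mathcal Y\Big\}<\infty$$ is precompact with respect to the relative weak-$*$ topology on $\mathbf Y^2(\Omega;E)\subset\mathbf E^2(\Omega;E)^*$: its closure in $\mathbf Y^2(\Omega;E)$ is weak-$*$ compact, and every sequence in $\mathcal Y$ has a subsequence that converges weak-$*$ to an element of $\mathbf Y^2(\Omega;E)$. -/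

import Mathlib

open MeasureTheory ProbabilityTheory Filter Topology Set
open scoped ENNReal BoundedContinuousFunction

noncomputable section

set_option linter.unusedSectionVars false

namespace TwoScale

/-! ### Measure-valued maps -/

section MeasureValued

variable {X Y : Type*} [MeasurableSpace X] [MeasurableSpace Y]

/-- A map `x ↦ κ x` into the probability measures on `Y` is weak-* `μ`-measurable if
`x ↦ κ x B` is `μ`-measurable (i.e. measurable up to a `μ`-null set) for all Borel sets `B`. -/
def WeakStarMeasurable (μ : Measure X) (κ : X → ProbabilityMeasure Y) : Prop :=
  ∀ B : Set Y, MeasurableSet B → AEMeasurable (fun x => (κ x : Measure Y) B) μ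

/-- The generalized product `μ ⊗ κ_x`, i.e. the measure
`U ↦ ∫ (∫ χ_U (x, y) dκ_x(y)) dμ(x)` on `X × Y` (see `semiProd_apply`). -/
def semiProd (μ : Measure X) (κ : X → ProbabilityMeasure Y) : Measure (X × Y) :=
  μ.bind fun x => (κ x : Measure Y).map (Prod.mk x)

/-- A weak-* `μ`-measurable family coincides `μ`-almost everywhere with a Markov kernel. -/
theorem WeakStarMeasurable.exists_kernel [MeasurableSpace.CountablyGenerated Y]
    {μ : Measure X} {κ : X → ProbabilityMeasure Y} (h : WeakStarMeasurable μ κ) :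
    ∃ η : Kernel X Y, IsMarkovKernel η ∧ ∀ᵐ x ∂μ, (κ x : Measure Y) = η x := by
  classical
  rcases isEmpty_or_nonempty X with hX | ⟨⟨x₀⟩⟩
  · refine ⟨⟨fun x => (κ x : Measure Y), measurable_of_empty _⟩,
      ⟨fun x => hX.elim x⟩, Filter.Eventually.of_forall fun x => hX.elim x⟩
  let A : Set (Set Y) :=
    generateSetAlgebra (MeasurableSpace.countableGeneratingSet Y)
  have hAc : A.Countable :=
    countable_generateSetAlgebra MeasurableSpace.countable_countableGeneratingSet
  have hAg : MeasurableSpace.generateFrom A = ‹MeasurableSpace Y› := by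
    rw [generateFrom_generateSetAlgebra_eq,
      MeasurableSpace.generateFrom_countableGeneratingSet]
  have hAm : ∀ B ∈ A, MeasurableSet B := fun B hB => by
    rw [← hAg]; exact MeasurableSpace.measurableSet_generateFrom hB
  have hApi : IsPiSystem A := fun s hs t ht _ =>
    isSetAlgebra_generateSetAlgebra.inter_mem hs ht
  have hall : ∀ᵐ x ∂μ, ∀ B : A, (κ x : Measure Y) B.1 = (h B.1 (hAm _ B.2)).mk _ x := by
    have : Countable A := hAc
    rw [ae_all_iff]
    exact fun B => (h B.1 (hAm _ B.2)).ae_eq_mk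
  obtain ⟨S, hSsub, hSm, hS0⟩ := exists_measurable_superset_of_null hall
  let κ' : X → ProbabilityMeasure Y := fun x => if x ∈ S then κ x₀ else κ x
  have hκ' : Measurable fun x => (κ' x : Measure Y) := by
    refine Measurable.measure_of_isPiSystem_of_isProbabilityMeasure hAg.symm hApi fun B hB => ?_
    have : (fun x => (κ' x : Measure Y) B) =
        fun x => if x ∈ S then (κ x₀ : Measure Y) B else (h B (hAm _ hB)).mk _ x := by
      funext x
      by_cases hx : x ∈ S
      · simp [κ', hx]
      · have : ¬ x ∈ {x | ¬ ∀ B : A, (κ x : Measure Y) B.1 = (h B.1 (hAm _ B.2)).mk _ x} :=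
          fun hx' => hx (hSsub hx')
        simp only [mem_ofPred_eq, not_not] at this
        simpa [κ', hx] using this ⟨B, hB⟩
    rw [this]
    exact Measurable.ite hSm measurable_const (h B (hAm _ hB)).measurable_mk
  refine ⟨⟨fun x => (κ' x : Measure Y), hκ'⟩, ⟨fun x => ?_⟩, ?_⟩
  · change IsProbabilityMeasure (κ' x : Measure Y)
    infer_instance
  · have : ∀ᵐ x ∂μ, x ∉ S := measure_eq_zero_iff_ae_notMem.1 hS0
    filter_upwards [this] with x hx
    change (κ x : Measure Y) = (κ' x : Measure Y)
    simp [κ', hx]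

theorem semiProd_congr_kernel [MeasurableSpace.CountablyGenerated Y] {μ : Measure X}
    [SFinite μ] {κ : X → ProbabilityMeasure Y} {η : Kernel X Y} [IsMarkovKernel η]
    (h : ∀ᵐ x ∂μ, (κ x : Measure Y) = η x) : semiProd μ κ = μ ⊗ₘ η := by
  have h1 : semiProd μ κ = μ.bind fun x => (η x).map (Prod.mk x) := by
    apply Measure.bind_congr_right
    filter_upwards [h] with x hx
    rw [hx]
  rw [h1]
  ext s hs
  have hm : Measurable fun x => (η x).map (Prod.mk x) := by
    refine Measure.measurable_of_measurable_coe _ fun t ht => ?_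
    have : (fun x => (η x).map (Prod.mk x) t) = fun x => η x (Prod.mk x ⁻¹' t) := by
      funext x
      rw [Measure.map_apply measurable_prodMk_left ht]
    rw [this]
    exact Kernel.measurable_kernel_prodMk_left ht
  rw [Measure.bind_apply hs hm.aemeasurable, Measure.compProd_apply hs]
  refine lintegral_congr fun x => ?_
  rw [Measure.map_apply measurable_prodMk_left hs]

/-- The defining formula of the generalized product. -/
theorem semiProd_apply [MeasurableSpace.CountablyGenerated Y] {μ : Measure X}
    [SFinite μ] {κ : X → ProbabilityMeasure Y} (h : WeakStarMeasurable μ κ)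
    {U : Set (X × Y)} (hU : MeasurableSet U) :
    semiProd μ κ U = ∫⁻ x, ∫⁻ y, U.indicator 1 (x, y) ∂(κ x : Measure Y) ∂μ := by
  obtain ⟨η, hη, hκ⟩ := h.exists_kernel
  rw [semiProd_congr_kernel hκ, Measure.compProd_apply hU]
  refine lintegral_congr_ae ?_
  filter_upwards [hκ] with x hx
  rw [hx]
  have : (fun y => U.indicator (1 : X × Y → ℝ≥0∞) (x, y))
      = (Prod.mk x ⁻¹' U).indicator 1 := by
    funext y; rfl
  rw [this, lintegral_indicator_one (measurable_prodMk_left hU)]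

end MeasureValued

/-! ### Domains, the torus and integrands -/

/-- The bounded open sets `Ω ⊆ ℝ^d` with Lebesgue-negligible boundary. -/
structure Domain (d : ℕ) where
  carrier : Set (EuclideanSpace ℝ (Fin d))
  isOpen : IsOpen carrier
  isBounded : Bornology.IsBounded carrier
  volume_frontier : volume (frontier carrier) = 0

/-- The `d`-dimensional flat torus `ℝ^d / ℤ^d`, with its Haar probability measure. -/
abbrev Torus (d : ℕ) : Type := UnitAddTorus (Fin d)

variable {d : ℕ} (Ω : Domain d)

/-- The points of `Ω`. -/
abbrev Pt : Type := Ω.carrier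

/-- The points of the closure of `Ω`. -/
abbrev ClPt : Type := closure Ω.carrier

instance : CompactSpace (ClPt Ω) :=
  isCompact_iff_compactSpace.1 Ω.isBounded.isCompact_closure

/-- Lebesgue measure on `Ω`. -/
def leb : Measure (Pt Ω) := volume.comap Subtype.val

/-- Lebesgue measure on the closure of `Ω`. -/
def lebCl : Measure (ClPt Ω) := volume.comap Subtype.val

/-- The inclusion of `Ω` in its closure. -/
def incl : Pt Ω → ClPt Ω := Set.inclusion subset_closure

theorem continuous_incl : Continuous (incl Ω) := continuous_inclusion subset_closure

theorem isOpen_range_incl : IsOpen (range (incl Ω)) := by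
  have : range (incl Ω) = ((↑) : ClPt Ω → EuclideanSpace ℝ (Fin d)) ⁻¹' Ω.carrier := by
    simp [incl, Set.range_inclusion]
    rfl
  rw [this]
  exact Ω.isOpen.preimage continuous_subtype_val


variable (E : Type*) [NormedAddCommGroup E] [InnerProductSpace ℝ E]

/-- The open unit ball of `E`. -/
abbrev UBall : Type _ := Metric.ball (0 : E) 1

/-- The closed unit ball of `E`, i.e. the closure of the open one. -/
abbrev ClUBall : Type _ := Metric.closedBall (0 : E) 1

/-- The unit sphere of `E`. -/
abbrev USphere : Type _ := Metric.sphere (0 : E) 1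

/-- The inclusion of the open in the closed unit ball. -/
def inclBall : UBall E → ClUBall E := Set.inclusion Metric.ball_subset_closedBall

instance [FiniteDimensional ℝ E] : CompactSpace (ClUBall E) :=
  isCompact_iff_compactSpace.1 (isCompact_closedBall _ _)

variable {Ω E}

/-- `(T f)(x, ξ, ẑ) = (1 - |ẑ|) f(x, ξ, ẑ / (1 - |ẑ|))` on `Ω × Z × 𝔹_E`. -/
def T (f : Pt Ω × Torus d × E → ℝ) (p : Pt Ω × Torus d × UBall E) : ℝ :=
  (1 - ‖(p.2.2 : E)‖) * f (p.1, p.2.1, (1 - ‖(p.2.2 : E)‖)⁻¹ • (p.2.2 : E))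

variable (Ω E) in
/-- The vector space `𝐄²(Ω; E)` of the continuous `f : Ω × Z × E → ℝ` for which `T f` extends to a
continuous function on `cl (Ω × Z × 𝔹_E) = cl Ω × Z × cl 𝔹_E`. -/
def integrandSubmodule : Submodule ℝ (Pt Ω × Torus d × E → ℝ) where
  carrier := {f | Continuous f ∧ ∃ g : C(ClPt Ω × Torus d × ClUBall E, ℝ),
    ∀ x ξ z, g (incl Ω x, ξ, inclBall E z) = T f (x, ξ, z)}
  add_mem' := by
    rintro f₁ f₂ ⟨h₁, g₁, hg₁⟩ ⟨h₂, g₂, hg₂⟩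
    refine ⟨h₁.add h₂, g₁ + g₂, fun x ξ z => ?_⟩
    simp [hg₁, hg₂, T, mul_add]
  zero_mem' := ⟨continuous_const, 0, fun x ξ z => by simp [T]⟩
  smul_mem' := by
    rintro c f ⟨h, g, hg⟩
    refine ⟨h.const_smul c, c • g, fun x ξ z => ?_⟩
    simp [hg, T, mul_left_comm]

variable (Ω E) in
/-- The space `𝐄²(Ω; E)`; it carries the norm `‖f‖ = ‖T f‖_∞` defined below. -/
def Integrand : Type _ := integrandSubmodule Ω E

namespace Integrand

instance : AddCommGroup (Integrand Ω E) := inferInstanceAs (AddCommGroup (integrandSubmodule Ω E))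
instance : Module ℝ (Integrand Ω E) := inferInstanceAs (Module ℝ (integrandSubmodule Ω E))

/-- The underlying function. -/
def toFun (f : Integrand Ω E) : Pt Ω × Torus d × E → ℝ := Subtype.val 
  (p := (· ∈ integrandSubmodule Ω E)) f

instance : CoeFun (Integrand Ω E) fun _ => Pt Ω × Torus d × E → ℝ := ⟨toFun⟩

theorem continuous (f : Integrand Ω E) : Continuous f := f.2.1

@[simp] theorem add_apply (f g : Integrand Ω E) (p) : (f + g) p = f p + g p := rfl
@[simp] theorem smul_apply (c : ℝ) (f : Integrand Ω E) (p) : (c • f) p = c * f p := rfl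

/-- The continuous extension of `T f` to the closure. -/
def ext (f : Integrand Ω E) : C(ClPt Ω × Torus d × ClUBall E, ℝ) := f.2.2.choose

theorem ext_spec (f : Integrand Ω E) (x : Pt Ω) (ξ : Torus d) (z : UBall E) :
    f.ext (incl Ω x, ξ, inclBall E z) = T f (x, ξ, z) := f.2.2.choose_spec x ξ z

theorem continuous_T (f : Integrand Ω E) : Continuous (T f) := by
  have : T f = fun p : Pt Ω × Torus d × UBall E =>
      f.ext (incl Ω p.1, p.2.1, inclBall E p.2.2) := by
    funext p; rw [ext_spec]
  rw [this]
  have h1 := continuous_incl Ω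
  have h2 : Continuous (inclBall E) := continuous_inclusion Metric.ball_subset_closedBall
  fun_prop

/-- The value of `f` recovered from `T f`. -/
theorem apply_eq (f : Integrand Ω E) (x : Pt Ω) (ξ : Torus d) (z : E)
    (hz : (1 + ‖z‖)⁻¹ • z ∈ Metric.ball (0 : E) 1) :
    f (x, ξ, z) = (1 + ‖z‖) * T f (x, ξ, ⟨(1 + ‖z‖)⁻¹ • z, hz⟩) := by
  have h0 : 0 < 1 + ‖z‖ := by positivity
  have h1 : 1 - ‖(1 + ‖z‖)⁻¹ • z‖ = (1 + ‖z‖)⁻¹ := by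
    rw [norm_smul, Real.norm_of_nonneg (by positivity)]
    field_simp
    ring
  simp only [T, h1, inv_inv, smul_smul]
  rw [mul_inv_cancel₀ h0.ne', one_smul, ← mul_assoc, mul_inv_cancel₀ h0.ne', one_mul]

theorem inv_smul_mem_ball (z : E) : (1 + ‖z‖)⁻¹ • z ∈ Metric.ball (0 : E) 1 := by
  have h0 : 0 < 1 + ‖z‖ := by positivity
  rw [mem_ball_zero_iff, norm_smul, Real.norm_of_nonneg (by positivity), inv_mul_lt_iff₀ h0]
  linarith

/-- `T f` as a bounded continuous function on `Ω × Z × 𝔹_E`. -/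
def toBCF [FiniteDimensional ℝ E] (f : Integrand Ω E) : (Pt Ω × Torus d × UBall E) →ᵇ ℝ :=
  BoundedContinuousFunction.ofNormedAddCommGroup (T f) f.continuous_T ‖f.ext‖ fun p => by
    rw [← ext_spec f p.1 p.2.1 p.2.2]
    exact f.ext.norm_coe_le_norm _

variable [FiniteDimensional ℝ E]

@[simp] theorem toBCF_apply (f : Integrand Ω E) (p) : f.toBCF p = T f p := rfl

/-- The linear map `T`, with values in the bounded continuous functions. -/
def toBCFLin : Integrand Ω E →ₗ[ℝ] (Pt Ω × Torus d × UBall E) →ᵇ ℝ where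
  toFun := toBCF
  map_add' f g := by ext p; simp [T, mul_add]
  map_smul' c f := by ext p; simp [T, mul_left_comm]

theorem toBCFLin_injective : Function.Injective (toBCFLin (Ω := Ω) (E := E)) := by
  intro f g h
  apply Subtype.ext
  funext p
  obtain ⟨x, ξ, z⟩ := p
  change f (x, ξ, z) = g (x, ξ, z)
  rw [f.apply_eq x ξ z (inv_smul_mem_ball z), g.apply_eq x ξ z (inv_smul_mem_ball z)]
  congr 1
  exact DFunLike.congr_fun h (x, ξ, ⟨_, inv_smul_mem_ball z⟩)

/-- The norm `‖f‖ = ‖T f‖_∞` of `𝐄²(Ω; E)`. -/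
instance : NormedAddCommGroup (Integrand Ω E) :=
  NormedAddCommGroup.induced _ _ toBCFLin toBCFLin_injective

theorem norm_def (f : Integrand Ω E) : ‖f‖ = ‖f.toBCF‖ := rfl

instance : NormedSpace ℝ (Integrand Ω E) where
  norm_smul_le c f := by
    have : (c • f).toBCF = c • f.toBCF := toBCFLin.map_smul c f
    rw [norm_def, norm_def, this]
    exact norm_smul_le c f.toBCF

/-- The linear growth of the elements of `𝐄²(Ω; E)`. -/
theorem abs_le (f : Integrand Ω E) (x : Pt Ω) (ξ : Torus d) (z : E) :
    |f (x, ξ, z)| ≤ ‖f‖ * (1 + ‖z‖) := by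
  have h0 : 0 < 1 + ‖z‖ := by positivity
  rw [f.apply_eq x ξ z (inv_smul_mem_ball z), abs_mul, abs_of_pos h0, mul_comm]
  gcongr
  exact f.toBCF.norm_coe_le_norm _

/-- The filter of the limits `x' → x` (with `x' ∈ Ω`), `ξ' → ξ`, `t → ∞`. -/
def recessionFilter (x : ClPt Ω) (ξ : Torus d) : Filter (Pt Ω × Torus d × ℝ) :=
  comap (incl Ω) (𝓝 x) ×ˢ 𝓝 ξ ×ˢ atTop

instance (x : ClPt Ω) (ξ : Torus d) : (recessionFilter x ξ).NeBot := by
  have : (comap (incl Ω) (𝓝 x)).NeBot := by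
    have h := mem_closure_iff_comap_neBot.1 x.2
    have e : comap (incl Ω) (𝓝 x)
        = comap ((↑) : Pt Ω → EuclideanSpace ℝ (Fin d)) (𝓝 (x : EuclideanSpace ℝ (Fin d))) := by
      rw [nhds_subtype_eq_comap, comap_comap]
      rfl
    rw [e]
    exact h
  unfold recessionFilter
  infer_instance

/-- The strong recession function
`f^∞(x, ξ, z) = lim f(x', ξ', t z) / t` as `x' → x`, `ξ' → ξ`, `t → ∞`. -/
def recession (f : Integrand Ω E) (x : ClPt Ω) (ξ : Torus d) (z : E) : ℝ :=
  limUnder (recessionFilter x ξ) fun p => f (p.1, p.2.1, p.2.2 • z) / p.2.2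

/-- On the unit sphere the limit in the definition of `f^∞` exists, and is given by the continuous
extension of `T f`. -/
theorem tendsto_recession (f : Integrand Ω E) (x : ClPt Ω) (ξ : Torus d) (z : USphere E) :
    Tendsto (fun p : Pt Ω × Torus d × ℝ => f (p.1, p.2.1, p.2.2 • (z : E)) / p.2.2)
      (recessionFilter x ξ) (𝓝 (f.ext (x, ξ, ⟨z, Metric.sphere_subset_closedBall z.2⟩))) := by
  have hz : ‖(z : E)‖ = 1 := by simp
  have hr : Tendsto (fun t : ℝ => (1 + t) / t) atTop (𝓝 1) := by
    have h1 : Tendsto (fun t : ℝ => t⁻¹ + 1) atTop (𝓝 (0 + 1)) :=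
      tendsto_inv_atTop_zero.add_const 1
    rw [zero_add] at h1
    refine h1.congr' ?_
    filter_upwards [eventually_gt_atTop 0] with t ht
    field_simp
  have hr' : Tendsto (fun t : ℝ => (1 + ‖t • (z : E)‖)⁻¹ • t • (z : E)) atTop (𝓝 (z : E)) := by
    have h1 : Tendsto (fun t : ℝ => ((1 + t) / t)⁻¹) atTop (𝓝 1) := by
      simpa using hr.inv₀ one_ne_zero
    have h2 : Tendsto (fun t : ℝ => ((1 + t) / t)⁻¹ • (z : E)) atTop (𝓝 ((1 : ℝ) • (z : E))) :=
      h1.smul_const _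
    rw [one_smul] at h2
    refine h2.congr' ?_
    filter_upwards [eventually_gt_atTop 0] with t ht
    rw [norm_smul, hz, Real.norm_of_nonneg ht.le, smul_smul, mul_one]
    congr 1
    field_simp
  have hx : Tendsto (fun p : Pt Ω × Torus d × ℝ => incl Ω p.1) (recessionFilter x ξ) (𝓝 x) :=
    tendsto_comap.comp tendsto_fst
  have hξ : Tendsto (fun p : Pt Ω × Torus d × ℝ => p.2.1) (recessionFilter x ξ) (𝓝 ξ) :=
    tendsto_fst.comp tendsto_snd
  have ht : Tendsto (fun p : Pt Ω × Torus d × ℝ => p.2.2) (recessionFilter x ξ) atTop :=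
    tendsto_snd.comp tendsto_snd
  have hb : Tendsto (fun p : Pt Ω × Torus d × ℝ =>
      inclBall E ⟨_, inv_smul_mem_ball (p.2.2 • (z : E))⟩) (recessionFilter x ξ)
      (𝓝 ⟨z, Metric.sphere_subset_closedBall z.2⟩) := by
    rw [tendsto_subtype_rng]
    exact hr'.comp ht
  have hg := (f.ext.continuous.tendsto (x, ξ, ⟨z, Metric.sphere_subset_closedBall z.2⟩)).comp
    (hx.prodMk_nhds (hξ.prodMk_nhds hb))
  have := (hr.comp ht).mul hg
  rw [one_mul] at this
  refine this.congr' ?_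
  filter_upwards [ht.eventually (eventually_gt_atTop 0)] with p hp
  simp only [Function.comp_apply]
  have hn : ‖p.2.2 • (z : E)‖ = p.2.2 := by
    rw [norm_smul, hz, Real.norm_of_nonneg hp.le, mul_one]
  rw [ext_spec, f.apply_eq _ _ _ (inv_smul_mem_ball (p.2.2 • (z : E))), mul_div_right_comm]
  exact congrArg (fun r => (1 + r) / p.2.2 * T f (p.1, p.2.1, _)) hn.symm

theorem recession_eq (f : Integrand Ω E) (x : ClPt Ω) (ξ : Torus d) (z : USphere E) :
    f.recession x ξ z = f.ext (x, ξ, ⟨z, Metric.sphere_subset_closedBall z.2⟩) :=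
  (f.tendsto_recession x ξ z).limUnder_eq

theorem continuous_recession (f : Integrand Ω E) :
    Continuous fun p : (ClPt Ω × Torus d) × USphere E => f.recession p.1.1 p.1.2 p.2 := by
  simp_rw [recession_eq]
  have h : Continuous fun z : USphere E =>
      (⟨z, Metric.sphere_subset_closedBall z.2⟩ : ClUBall E) :=
    continuous_inclusion Metric.sphere_subset_closedBall
  exact f.ext.continuous.comp (by fun_prop)

theorem recession_add (f g : Integrand Ω E) (x : ClPt Ω) (ξ : Torus d) (z : USphere E) :
    (f + g).recession x ξ z = f.recession x ξ z + g.recession x ξ z := by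
  rw [f.recession_eq, g.recession_eq]
  refine Tendsto.limUnder_eq (((f.tendsto_recession x ξ z).add
    (g.tendsto_recession x ξ z)).congr fun p => ?_)
  rw [add_apply, add_div]

theorem recession_smul (c : ℝ) (f : Integrand Ω E) (x : ClPt Ω) (ξ : Torus d) (z : USphere E) :
    (c • f).recession x ξ z = c * f.recession x ξ z := by
  rw [f.recession_eq]
  refine Tendsto.limUnder_eq (((f.tendsto_recession x ξ z).const_mul c).congr fun p => ?_)
  rw [smul_apply, mul_div_assoc]

theorem abs_recession_le (f : Integrand Ω E) (x : ClPt Ω) (ξ : Torus d) (z : USphere E) :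
    |f.recession x ξ z| ≤ ‖f‖ := by
  have hz : ‖(z : E)‖ = 1 := by simp
  rw [f.recession_eq]
  have ht : Tendsto (fun p : Pt Ω × Torus d × ℝ => p.2.2) (recessionFilter x ξ) atTop :=
    tendsto_snd.comp tendsto_snd
  have h2 : Tendsto (fun p : Pt Ω × Torus d × ℝ => ‖f‖ * (1 + p.2.2⁻¹)) (recessionFilter x ξ)
      (𝓝 (‖f‖ * (1 + 0))) :=
    ((tendsto_inv_atTop_zero.comp ht).const_add 1).const_mul _
  rw [add_zero, mul_one] at h2
  refine le_of_tendsto_of_tendsto (f.tendsto_recession x ξ z).abs h2 ?_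
  filter_upwards [ht.eventually (eventually_gt_atTop 0)] with p hp
  rw [abs_div, abs_of_pos hp, div_le_iff₀ hp]
  refine (f.abs_le _ _ _).trans (le_of_eq ?_)
  rw [norm_smul, hz, Real.norm_of_nonneg hp.le]
  field_simp
  ring

end Integrand

/-! ### Lebesgue measure on `Ω` and on its closure -/

theorem measurableEmbedding_incl : MeasurableEmbedding (incl Ω) :=
  (IsOpenEmbedding.mk ⟨Topology.IsEmbedding.inclusion subset_closure |>.toIsInducing,
    Set.inclusion_injective _⟩ (isOpen_range_incl Ω)).measurableEmbedding

theorem measurePreserving_incl :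
    MeasurePreserving (incl Ω) (leb Ω) ((lebCl Ω).restrict (range (incl Ω))) := by
  refine ⟨(continuous_incl Ω).measurable, ?_⟩
  ext s hs
  rw [Measure.map_apply (continuous_incl Ω).measurable hs, Measure.restrict_apply hs, leb, lebCl,
    comap_subtype_coe_apply Ω.isOpen.measurableSet, comap_subtype_coe_apply measurableSet_closure]
  congr 1
  ext y
  constructor
  · rintro ⟨x, hx, rfl⟩
    exact ⟨incl Ω x, ⟨hx, x, rfl⟩, rfl⟩
  · rintro ⟨_, ⟨hx, x, rfl⟩, rfl⟩
    exact ⟨x, hx, rfl⟩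

instance : IsFiniteMeasure (leb Ω) := by
  refine ⟨?_⟩
  rw [leb, comap_subtype_coe_apply Ω.isOpen.measurableSet]
  exact (measure_mono (by simp : Subtype.val '' (univ : Set (Pt Ω)) ⊆ Ω.carrier)).trans_lt Ω.isBounded.measure_lt_top

instance : IsFiniteMeasure (lebCl Ω) := by
  refine ⟨?_⟩
  rw [lebCl, comap_subtype_coe_apply measurableSet_closure]
  exact (measure_mono (by simp)).trans_lt Ω.isBounded.closure.measure_lt_top

theorem measurePreserving_incl_prod :
    MeasurePreserving (Prod.map (incl Ω) (id : Torus d → Torus d)) ((leb Ω).prod volume)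
      (((lebCl Ω).prod volume).restrict (range (incl Ω) ×ˢ univ)) := by
  rw [← Measure.prod_restrict, Measure.restrict_univ]
  exact measurePreserving_incl.prod (MeasurePreserving.id _)

/-! ### Two-scale* Young measures -/

variable [MeasurableSpace E]

variable (Ω E) in
/-- A two-scale* Young measure `(ν, λ, ρ, ν^∞)` on `Ω` with values in `E`. -/
structure YoungMeasure where
  /-- the family `ν_{x,ξ}` of probability measures on `E` -/
  ν : ClPt Ω × Torus d → ProbabilityMeasure E
  /-- the measure `λ` on `cl Ω` -/
  lam : Measure (ClPt Ω)
  /-- the family `ρ_x` of probability measures on the torus -/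
  ρ : ClPt Ω → ProbabilityMeasure (Torus d)
  /-- the family `ν^∞_{x,ξ}` of probability measures on the unit sphere of `E` -/
  νInf : ClPt Ω × Torus d → ProbabilityMeasure (USphere E)
  /-- `ν` is weak-* measurable (with respect to Lebesgue measure) -/
  measurable_ν : WeakStarMeasurable ((lebCl Ω).prod volume) ν
  /-- `(x, ξ) ↦ ⟨|·|, ν_{x,ξ}⟩` is integrable -/
  integrable_ν : ∫⁻ p, ∫⁻ z, ‖z‖ₑ ∂(ν p : Measure E) ∂((lebCl Ω).prod volume) < ∞
  /-- `λ` is a bounded measure -/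
  isFiniteMeasure_lam : IsFiniteMeasure lam
  /-- `ρ` is weak-* `λ`-measurable -/
  measurable_ρ : WeakStarMeasurable lam ρ
  /-- `ν^∞` is weak-* `(λ ⊗ ρ_x)`-measurable -/
  measurable_νInf : WeakStarMeasurable (semiProd lam ρ) νInf

namespace YoungMeasure

attribute [instance] isFiniteMeasure_lam

/-- `∫_{cl Ω} ∫_Z ⟨1 + |·|, ν_{x,ξ}⟩ dξ dx + λ(cl Ω)`. -/
def mass (nu : YoungMeasure Ω E) : ℝ≥0∞ :=
  (∫⁻ x, ∫⁻ ξ, ∫⁻ z, (1 + ‖z‖ₑ) ∂(nu.ν (x, ξ) : Measure E) ∂volume ∂lebCl Ω) + nu.lam univ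

/-- The duality pairing
`⟨⟨f, ν⟩⟩ = ∫_Ω ∫_Z ⟨f(x,ξ,·), ν_{x,ξ}⟩ dξ dx + ∫_{cl Ω} ∫_Z ⟨f^∞(x,ξ,·), ν^∞_{x,ξ}⟩ dρ_x(ξ) dλ(x)`.
-/
def pairing (f : Integrand Ω E) (nu : YoungMeasure Ω E) : ℝ :=
  (∫ x, ∫ ξ, ∫ z, f (x, ξ, z) ∂(nu.ν (incl Ω x, ξ) : Measure E) ∂volume ∂leb Ω) +
  ∫ x, ∫ ξ, ∫ z : USphere E, f.recession x ξ z ∂(nu.νInf (x, ξ) : Measure (USphere E))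
    ∂(nu.ρ x : Measure (Torus d)) ∂nu.lam

/-! The pairing is a continuous linear functional of the integrand. -/

variable [FiniteDimensional ℝ E] [BorelSpace E] (nu : YoungMeasure Ω E)

theorem lintegral_ν_ne_top :
    ∫⁻ p, ∫⁻ z, (1 + ‖z‖ₑ) ∂(nu.ν p : Measure E) ∂((lebCl Ω).prod volume) < ∞ := by
  have h : ∀ p, ∫⁻ z, (1 + ‖z‖ₑ) ∂(nu.ν p : Measure E) = 1 + ∫⁻ z, ‖z‖ₑ ∂(nu.ν p : Measure E) :=
    fun p => by
      rw [lintegral_add_left measurable_const]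
      simp
  simp_rw [h]
  rw [lintegral_add_left measurable_const]
  simp only [lintegral_const, one_mul]
  exact ENNReal.add_lt_top.2 ⟨measure_lt_top _ _, nu.integrable_ν⟩

theorem aemeasurable_lintegral_ν :
    AEMeasurable (fun p => ∫⁻ z, (1 + ‖z‖ₑ) ∂(nu.ν p : Measure E)) ((lebCl Ω).prod volume) := by
  obtain ⟨η, hη, h⟩ := nu.measurable_ν.exists_kernel
  refine ⟨fun p => ∫⁻ z, (1 + ‖z‖ₑ) ∂(η p),
    (measurable_const.add measurable_enorm).lintegral_kernel, ?_⟩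
  filter_upwards [h] with p hp
  rw [hp]

theorem mass_lt_top : nu.mass < ∞ := by
  refine ENNReal.add_lt_top.2 ⟨?_, measure_lt_top _ _⟩
  have := nu.lintegral_ν_ne_top
  rwa [lintegral_prod _ nu.aemeasurable_lintegral_ν] at this

theorem enorm_integral_ν_le (f : Integrand Ω E) (x : Pt Ω) (ξ : Torus d) :
    ‖∫ z, f (x, ξ, z) ∂(nu.ν (incl Ω x, ξ) : Measure E)‖ₑ
      ≤ ‖f‖ₑ * ∫⁻ z, (1 + ‖z‖ₑ) ∂(nu.ν (incl Ω x, ξ) : Measure E) := by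
  refine (enorm_integral_le_lintegral_enorm _).trans ?_
  rw [← lintegral_const_mul' _ _ (enorm_ne_top (x := f))]
  refine lintegral_mono fun z => ?_
  have h := f.abs_le x ξ z
  rw [← Real.norm_eq_abs] at h
  have h' := ENNReal.ofReal_le_ofReal h
  rw [ofReal_norm, ENNReal.ofReal_mul (norm_nonneg _), ENNReal.ofReal_add (by simp)
    (norm_nonneg _), ofReal_norm, ofReal_norm, ENNReal.ofReal_one] at h'
  exact h'

/-- The estimate of the pairing by the norm of the integrand. -/
theorem enorm_pairing_le (f : Integrand Ω E) : ‖pairing f nu‖ₑ ≤ ‖f‖ₑ * nu.mass := by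
  have h2 : ‖∫ x, ∫ ξ, ∫ z, f (x, ξ, z) ∂(nu.ν (incl Ω x, ξ) : Measure E) ∂volume ∂leb Ω‖ₑ
      ≤ ‖f‖ₑ * ∫⁻ x, ∫⁻ ξ, ∫⁻ z, (1 + ‖z‖ₑ) ∂(nu.ν (x, ξ) : Measure E) ∂volume ∂lebCl Ω := by
    calc _ ≤ ∫⁻ x, ∫⁻ ξ, ‖f‖ₑ * ∫⁻ z, (1 + ‖z‖ₑ) ∂(nu.ν (incl Ω x, ξ) : Measure E)
            ∂volume ∂leb Ω := by
          refine (enorm_integral_le_lintegral_enorm _).trans (lintegral_mono fun x => ?_)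
          exact (enorm_integral_le_lintegral_enorm _).trans (lintegral_mono fun ξ => nu.enorm_integral_ν_le f x ξ)
      _ = ‖f‖ₑ * ∫⁻ x, ∫⁻ ξ, ∫⁻ z, (1 + ‖z‖ₑ) ∂(nu.ν (incl Ω x, ξ) : Measure E)
            ∂volume ∂leb Ω := by
          simp_rw [lintegral_const_mul' _ _ (enorm_ne_top (x := f))]
      _ ≤ _ := by
          refine mul_le_mul_right ?_ _
          rw [measurePreserving_incl.lintegral_comp_emb measurableEmbedding_incl
            (fun x => ∫⁻ ξ, ∫⁻ z, (1 + ‖z‖ₑ) ∂(nu.ν (x, ξ) : Measure E) ∂volume)]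
          exact setLIntegral_le_lintegral _ _
  have h3 : ∀ (x : ClPt Ω) (ξ : Torus d) (z : USphere E), ‖f.recession x ξ z‖ₑ ≤ ‖f‖ₑ :=
    fun x ξ z => by
      have h := f.abs_recession_le x ξ z
      rw [← Real.norm_eq_abs] at h
      have h' := ENNReal.ofReal_le_ofReal h
      rwa [ofReal_norm, ofReal_norm] at h'
  have h4 : ‖∫ x, ∫ ξ, ∫ z : USphere E, f.recession x ξ z
      ∂(nu.νInf (x, ξ) : Measure (USphere E)) ∂(nu.ρ x : Measure (Torus d)) ∂nu.lam‖ₑ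
      ≤ ‖f‖ₑ * nu.lam univ := by
    refine (enorm_integral_le_lintegral_enorm _).trans ?_
    rw [← lintegral_const]
    refine lintegral_mono fun x => (enorm_integral_le_lintegral_enorm _).trans ?_
    refine (lintegral_mono (g := fun _ => ‖f‖ₑ) fun ξ =>
      (enorm_integral_le_lintegral_enorm _).trans ?_).trans (by simp)
    exact (lintegral_mono (g := fun _ => ‖f‖ₑ) fun z => h3 x ξ z).trans (by simp)
  rw [pairing, mass, mul_add]
  exact (enorm_add_le _ _).trans (add_le_add h2 h4)

theorem ae_integrable (f : Integrand Ω E) : ∀ᵐ p ∂((leb Ω).prod (volume : Measure (Torus d))),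
    Integrable (fun z => f (p.1, p.2, z)) (nu.ν (incl Ω p.1, p.2) : Measure E) := by
  have h := ae_lt_top' nu.aemeasurable_lintegral_ν nu.lintegral_ν_ne_top.ne
  have h' := measurePreserving_incl_prod.quasiMeasurePreserving.ae (ae_restrict_of_ae h)
  filter_upwards [h'] with p hp
  have hi : Integrable (fun z : E => 1 + ‖z‖) (nu.ν (incl Ω p.1, p.2) : Measure E) := by
    refine ⟨by fun_prop, ?_⟩
    refine lt_of_le_of_lt (lintegral_mono fun z => ?_) hp
    refine (enorm_add_le _ _).trans ?_
    simp
  refine (hi.const_mul ‖f‖).mono' ?_ (Eventually.of_forall fun z => f.abs_le _ _ z)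
  exact (f.continuous.comp (by fun_prop : Continuous fun z : E => (p.1, p.2, z))).aestronglyMeasurable

theorem integrable_osc (f : Integrand Ω E) :
    Integrable (fun p : Pt Ω × Torus d => ∫ z, f (p.1, p.2, z) ∂(nu.ν (incl Ω p.1, p.2) : Measure E))
      ((leb Ω).prod volume) := by
  obtain ⟨η, hη, h⟩ := nu.measurable_ν.exists_kernel
  have h' := measurePreserving_incl_prod.quasiMeasurePreserving.ae (ae_restrict_of_ae h)
  have hm : Measurable (Prod.map (incl Ω) (id : Torus d → Torus d)) :=
    (continuous_incl Ω).measurable.prodMap measurable_id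
  constructor
  · refine ⟨fun p => ∫ z, f (p.1, p.2, z) ∂(η.comap _ hm p), ?_, ?_⟩
    · have hc : Continuous fun q : (Pt Ω × Torus d) × E => f (q.1.1, q.1.2, q.2) :=
        f.continuous.comp (by fun_prop)
      exact hc.stronglyMeasurable.integral_kernel_prod_right'
    · filter_upwards [h'] with p hp
      rw [Kernel.comap_apply, ← hp]
      rfl
  · refine (lintegral_mono fun p : Pt Ω × Torus d =>
      nu.enorm_integral_ν_le f p.1 p.2).trans_lt ?_
    rw [lintegral_const_mul' _ _ enorm_ne_top]
    refine ENNReal.mul_lt_top enorm_lt_top ?_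
    have he : MeasurableEmbedding (Prod.map (incl Ω) (id : Torus d → Torus d)) :=
      measurableEmbedding_incl.prodMap MeasurableEmbedding.id
    have := measurePreserving_incl_prod.lintegral_comp_emb he
      (fun p : ClPt Ω × Torus d => ∫⁻ z, (1 + ‖z‖ₑ) ∂(nu.ν p : Measure E))
    refine lt_of_eq_of_lt this ?_
    exact (setLIntegral_le_lintegral _ _).trans_lt nu.lintegral_ν_ne_top

theorem osc_add (f g : Integrand Ω E) :
    (∫ x, ∫ ξ, ∫ z, (f + g) (x, ξ, z) ∂(nu.ν (incl Ω x, ξ) : Measure E) ∂volume ∂leb Ω) =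
    (∫ x, ∫ ξ, ∫ z, f (x, ξ, z) ∂(nu.ν (incl Ω x, ξ) : Measure E) ∂volume ∂leb Ω) +
    ∫ x, ∫ ξ, ∫ z, g (x, ξ, z) ∂(nu.ν (incl Ω x, ξ) : Measure E) ∂volume ∂leb Ω := by
  rw [← integral_prod _ (nu.integrable_osc (f + g)), ← integral_prod _ (nu.integrable_osc f),
    ← integral_prod _ (nu.integrable_osc g),
    ← integral_add (nu.integrable_osc f) (nu.integrable_osc g)]
  refine integral_congr_ae ?_
  filter_upwards [nu.ae_integrable f, nu.ae_integrable g] with p hf hg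
  rw [← integral_add hf hg]
  rfl

theorem integrable_recession (f : Integrand Ω E) (p : ClPt Ω × Torus d) :
    Integrable (fun z : USphere E => f.recession p.1 p.2 z)
      (nu.νInf p : Measure (USphere E)) := by
  refine Integrable.of_bound (C := ‖f‖) ?_ (Eventually.of_forall fun z => f.abs_recession_le _ _ z)
  exact (f.continuous_recession.comp
    (by fun_prop : Continuous fun z : USphere E => (p, z))).aestronglyMeasurable

theorem integrable_conc (f : Integrand Ω E) :
    Integrable (fun p : ClPt Ω × Torus d =>
      ∫ z : USphere E, f.recession p.1 p.2 z ∂(nu.νInf p : Measure (USphere E)))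
      (semiProd nu.lam nu.ρ) := by
  obtain ⟨η, hη, h⟩ := nu.measurable_ρ.exists_kernel
  have : IsFiniteMeasure (semiProd nu.lam nu.ρ) := by
    rw [semiProd_congr_kernel h]; infer_instance
  obtain ⟨κ, hκ, h'⟩ := nu.measurable_νInf.exists_kernel
  refine Integrable.of_bound (C := ‖f‖) ?_ (Eventually.of_forall fun p => ?_)
  · refine ⟨fun p => ∫ z : USphere E, f.recession p.1 p.2 z ∂(κ p), ?_, ?_⟩
    · exact f.continuous_recession.stronglyMeasurable.integral_kernel_prod_right'
    · filter_upwards [h'] with p hp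
      rw [hp]
  · refine (norm_integral_le_of_norm_le_const (C := ‖f‖)
      (Eventually.of_forall fun z => f.abs_recession_le _ _ z)).trans ?_
    simp

theorem conc_eq (f : Integrand Ω E) :
    ∫ x, ∫ ξ, ∫ z : USphere E, f.recession x ξ z
      ∂(nu.νInf (x, ξ) : Measure (USphere E)) ∂(nu.ρ x : Measure (Torus d)) ∂nu.lam =
    ∫ p, ∫ z : USphere E, f.recession p.1 p.2 z ∂(nu.νInf p : Measure (USphere E))
      ∂(semiProd nu.lam nu.ρ) := by
  have hi := nu.integrable_conc f
  obtain ⟨η, hη, h⟩ := nu.measurable_ρ.exists_kernel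
  rw [semiProd_congr_kernel h] at hi ⊢
  rw [Measure.integral_compProd hi]
  refine integral_congr_ae ?_
  filter_upwards [h] with x hx
  rw [hx]

theorem pairing_add (f g : Integrand Ω E) : pairing (f + g) nu = pairing f nu + pairing g nu := by
  rw [pairing, pairing, pairing, osc_add, conc_eq, conc_eq, conc_eq, add_add_add_comm,
    ← integral_add (nu.integrable_conc f) (nu.integrable_conc g)]
  congr 2
  funext p
  rw [← integral_add (nu.integrable_recession f p) (nu.integrable_recession g p)]
  simp_rw [Integrand.recession_add]

theorem pairing_smul (c : ℝ) (f : Integrand Ω E) : pairing (c • f) nu = c * pairing f nu := by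
  rw [pairing, pairing, mul_add]
  simp_rw [Integrand.recession_smul, Integrand.smul_apply, integral_const_mul]

/-- The element `⟨⟨·, ν⟩⟩` of the dual `𝐄²(Ω; E)*`, with its weak-* topology, which is identified
with the two-scale* Young measure. -/
def toDual (nu : YoungMeasure Ω E) : WeakDual ℝ (Integrand Ω E) :=
  StrongDual.toWeakDual <| LinearMap.mkContinuous
    { toFun := fun f => pairing f nu
      map_add' := nu.pairing_add
      map_smul' := nu.pairing_smul } nu.mass.toReal fun f => by
    have h := ENNReal.toReal_mono (ENNReal.mul_ne_top enorm_ne_top nu.mass_lt_top.ne)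
      (nu.enorm_pairing_le f)
    rw [ENNReal.toReal_mul, toReal_enorm, toReal_enorm, mul_comm] at h
    exact h

@[simp] theorem toDual_apply (f : Integrand Ω E) : nu.toDual f = pairing f nu := rfl

end YoungMeasure

variable (Ω E) in
/-- The set `𝐘²(Ω; E)` of two-scale* Young measures, as a subset of `𝐄²(Ω; E)*`. -/
def youngMeasures [FiniteDimensional ℝ E] [BorelSpace E] : Set (WeakDual ℝ (Integrand Ω E)) :=
  range YoungMeasure.toDual

end TwoScale

end

noncomputable section

set_option linter.unusedSectionVars false

namespace TwoScale

/-! Write `K` for the compact space `cl Ω × Z × cl 𝔹_E`. Since `Ω × Z × 𝔹_E` is dense in `K`, the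
map `f ↦ f.ext` identifies `𝐄²(Ω; E)` with `C(K, ℝ)`, and a functional on integrands that is
nonnegative on `f.ext ≥ 0` is a finite measure `μ` on `K` by Riesz–Markov.

A Young measure gives a positive functional, and on integrands `φ(x, ξ)` independent of `z`, whose
extension is `(1 - |z|) φ`, it takes the value `∫ φ dξ dx`: the recession function of `φ` vanishes.
Conversely, these two properties suffice (`youngMeasures_eq`). The part of `μ` over the open ball,
weighted by `1 - |z|` and pushed forward by `z ↦ z / (1 - |z|)`, has Lebesgue marginal on `cl Ω ×
Z`, and disintegration gives `ν`. The part on the sphere disintegrates over `cl Ω × Z` into `ν^∞`,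
and its marginal disintegrates over `cl Ω` into `λ` and `ρ` (`exists_youngMeasure`).

Both properties are conditions on the values of the functional at fixed integrands, hence weak-*
closed, so `𝐘²` is weak-* closed (`isClosed_youngMeasures`). The mass bounds the dual norm, so
Banach–Alaoglu gives compactness, and separability of `𝐄²` gives convergent subsequences. -/

theorem exists_measure_integral_eq_of_nonneg {X : Type*} [TopologicalSpace X] [CompactSpace X]
    [T2Space X] [MeasurableSpace X] [BorelSpace X] (Λ : C(X, ℝ) →ₗ[ℝ] ℝ)
    (hΛ : ∀ g : C(X, ℝ), 0 ≤ g → 0 ≤ Λ g) :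
    ∃ μ : Measure X, IsFiniteMeasure μ ∧ ∀ g : C(X, ℝ), ∫ x, g x ∂μ = Λ g := by
  -- On a compact space every continuous function has compact support, so `Λ` is a positive
  -- functional of the kind that Riesz–Markov represents.
  let Φ : CompactlySupportedContinuousMap X ℝ →ₚ[ℝ] ℝ := PositiveLinearMap.mk₀
    { toFun := fun g => Λ g.toContinuousMap
      map_add' := fun f g => Λ.map_add f.toContinuousMap g.toContinuousMap
      map_smul' := fun c g => Λ.map_smul c g.toContinuousMap }
    fun g hg => hΛ g.toContinuousMap hg
  exact ⟨RealRMK.rieszMeasure Φ, inferInstance, fun g =>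
    RealRMK.integral_rieszMeasure Φ (CompactlySupportedContinuousMap.continuousMapEquiv g)⟩

/-! ### Passing from `Ω` to its closure -/

section Domain

variable {d : ℕ} {Ω : Domain d}

theorem denseRange_incl : DenseRange (incl Ω) :=
  denseRange_inclusion_iff subset_closure |>.2 Subset.rfl

/-- The only place where the boundary of `Ω` has to be Lebesgue-null. It allows the first term of
the pairing, an integral over `Ω`, to be compared with measures on `cl Ω`. -/
theorem lebCl_restrict_range_incl : (lebCl Ω).restrict (range (incl Ω)) = lebCl Ω := by
  refine Measure.restrict_eq_self_of_ae_mem ?_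
  change lebCl Ω (range (incl Ω))ᶜ = 0
  rw [lebCl, comap_subtype_coe_apply measurableSet_closure]
  refine measure_mono_null ?_ Ω.volume_frontier
  rintro _ ⟨y, hy, rfl⟩
  rw [Ω.isOpen.frontier_eq]
  exact ⟨y.2, fun h => hy ⟨⟨y, h⟩, rfl⟩⟩

theorem integral_comp_incl_prod (G : ClPt Ω × Torus d → ℝ) :
    ∫ p, G (incl Ω p.1, p.2) ∂((leb Ω).prod (volume : Measure (Torus d)))
      = ∫ p, G p ∂((lebCl Ω).prod volume) := by
  have h := (measurePreserving_incl_prod (Ω := Ω)).integral_comp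
    (measurableEmbedding_incl.prodMap MeasurableEmbedding.id) G
  rw [← Measure.prod_restrict, Measure.restrict_univ, lebCl_restrict_range_incl] at h
  exact h

end Domain

/-! ### The rescaling between `E` and the unit ball -/

section Ball

variable {E : Type*} [NormedAddCommGroup E] [InnerProductSpace ℝ E]

theorem continuous_inclBall : Continuous (inclBall E) :=
  continuous_inclusion Metric.ball_subset_closedBall

theorem denseRange_inclBall : DenseRange (inclBall E) :=
  denseRange_inclusion_iff Metric.ball_subset_closedBall |>.2
    (closure_ball (0 : E) one_ne_zero).superset

theorem one_add_norm_inv_smul {z : E} (hz : ‖z‖ < 1) :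
    1 + ‖(1 - ‖z‖)⁻¹ • z‖ = (1 - ‖z‖)⁻¹ := by
  have h0 : 0 < 1 - ‖z‖ := sub_pos.2 hz
  rw [norm_smul, Real.norm_of_nonneg (by positivity)]
  field_simp
  ring

theorem inv_smul_inv_smul_of_norm_lt {z : E} (hz : ‖z‖ < 1) :
    (1 + ‖(1 - ‖z‖)⁻¹ • z‖)⁻¹ • (1 - ‖z‖)⁻¹ • z = z := by
  have h0 : 0 < 1 - ‖z‖ := sub_pos.2 hz
  rw [one_add_norm_inv_smul hz, inv_inv, smul_smul, mul_inv_cancel₀ h0.ne', one_smul]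

/-- The map `z ↦ z / (1 + |z|)` from `E` to the closed unit ball. -/
def toClUBall (z : E) : ClUBall E := inclBall E ⟨_, Integrand.inv_smul_mem_ball z⟩

theorem continuous_toClUBall : Continuous (toClUBall (E := E)) := by
  refine continuous_inclBall.comp (Continuous.subtype_mk ?_ _)
  refine Continuous.smul (Continuous.inv₀ (by fun_prop) fun z => ?_) continuous_id
  positivity

theorem toClUBall_inv_smul (z : ClUBall E) (hz : ‖(z : E)‖ < 1) :
    toClUBall ((1 - ‖(z : E)‖)⁻¹ • (z : E)) = z :=
  Subtype.ext (inv_smul_inv_smul_of_norm_lt hz)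

end Ball

/-! ### Identification of the integrands with `C(cl Ω × Z × cl 𝔹_E, ℝ)` -/

variable {d : ℕ} {Ω : Domain d} {E : Type*} [NormedAddCommGroup E] [InnerProductSpace ℝ E]

/-- The function `(p, z) ↦ (1 + |z|) g(p, z / (1 + |z|))`. -/
def unscale (g : C(ClPt Ω × Torus d × ClUBall E, ℝ)) (q : (ClPt Ω × Torus d) × E) : ℝ :=
  (1 + ‖q.2‖) * g (q.1.1, q.1.2, toClUBall q.2)

theorem continuous_unscale (g : C(ClPt Ω × Torus d × ClUBall E, ℝ)) :
    Continuous (unscale g) := by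
  have := continuous_toClUBall (E := E)
  unfold unscale
  fun_prop

/-- `unscale` inverts `T`: the growth factor at `z / (1 - |z|)` is `1 / (1 - |z|)`, which cancels
the weight. -/
theorem unscale_inv_smul (g : C(ClPt Ω × Torus d × ClUBall E, ℝ)) (x : ClPt Ω) (ξ : Torus d)
    (z : ClUBall E) (hz : ‖(z : E)‖ < 1) :
    (1 - ‖(z : E)‖) * unscale g ((x, ξ), (1 - ‖(z : E)‖)⁻¹ • (z : E)) = g (x, ξ, z) := by
  have h0 : 0 < 1 - ‖(z : E)‖ := sub_pos.2 hz
  simp only [unscale]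
  rw [toClUBall_inv_smul z hz, one_add_norm_inv_smul hz, ← mul_assoc, mul_inv_cancel₀ h0.ne',
    one_mul]

namespace Integrand

theorem ext_unique (f : Integrand Ω E) (g : C(ClPt Ω × Torus d × ClUBall E, ℝ))
    (h : ∀ x ξ z, g (incl Ω x, ξ, inclBall E z) = T f (x, ξ, z)) : f.ext = g := by
  have hd : DenseRange (Prod.map (incl Ω) (Prod.map (id : Torus d → Torus d) (inclBall E))) :=
    denseRange_incl.prodMap (denseRange_id.prodMap denseRange_inclBall)
  refine DFunLike.coe_injective (hd.equalizer f.ext.continuous g.continuous ?_)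
  funext p
  exact (f.ext_spec _ _ _).trans (h _ _ _).symm

/-- The integrand `f` such that `g` is the extension of `T f`. -/
def ofExt : C(ClPt Ω × Torus d × ClUBall E, ℝ) →ₗ[ℝ] Integrand Ω E where
  toFun g := ⟨fun p => unscale g ((incl Ω p.1, p.2.1), p.2.2), by
    have h1 := continuous_unscale g
    have h2 := continuous_incl Ω
    refine ⟨by fun_prop, g, fun x ξ z => ?_⟩
    exact (unscale_inv_smul g (incl Ω x) ξ (inclBall E z) (mem_ball_zero_iff.1 z.2)).symm⟩
  map_add' g₁ g₂ := Subtype.ext <| funext fun p => mul_add _ _ _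
  map_smul' c g := Subtype.ext <| funext fun p => mul_left_comm _ _ _

@[simp] theorem ext_ofExt (g : C(ClPt Ω × Torus d × ClUBall E, ℝ)) : (ofExt g).ext = g :=
  ext_unique _ _ fun x ξ z =>
    (unscale_inv_smul g (incl Ω x) ξ (inclBall E z) (mem_ball_zero_iff.1 z.2)).symm

theorem apply_eq_unscale (f : Integrand Ω E) (x : Pt Ω) (ξ : Torus d) (z : E) :
    f (x, ξ, z) = unscale f.ext ((incl Ω x, ξ), z) := by
  rw [f.apply_eq x ξ z (inv_smul_mem_ball z), ← f.ext_spec]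
  rfl

@[simp] theorem ofExt_ext (f : Integrand Ω E) : ofExt f.ext = f :=
  Subtype.ext <| funext fun p => (f.apply_eq_unscale p.1 p.2.1 p.2.2).symm

variable [FiniteDimensional ℝ E]

theorem norm_ofExt_le (g : C(ClPt Ω × Torus d × ClUBall E, ℝ)) : ‖ofExt g‖ ≤ ‖g‖ := by
  rw [norm_def, BoundedContinuousFunction.norm_le (norm_nonneg _)]
  intro p
  rw [toBCF_apply, ← ext_spec (ofExt g) p.1 p.2.1 p.2.2, ext_ofExt]
  exact g.norm_coe_le_norm _

/-- Separability passes from the continuous functions on a compact metrizable space to their image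
under the continuous surjection `ofExt`. It is needed for the sequential form of Banach–Alaoglu. -/
instance : TopologicalSpace.SeparableSpace (Integrand Ω E) := by
  have hc : Continuous (ofExt (Ω := Ω) (E := E)) :=
    AddMonoidHomClass.continuous_of_bound ofExt 1 fun g => by simpa using norm_ofExt_le g
  have hs : Function.Surjective (ofExt (Ω := Ω) (E := E)) := fun f => ⟨f.ext, ofExt_ext f⟩
  exact hs.denseRange.separableSpace hc

end Integrand

/-! ### Integrands independent of `z`, and the sphere at infinity -/

/-- The function `(x, ξ, z) ↦ (1 - |z|) φ(x, ξ)`, which extends `T φ`. -/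
def weighted (φ : C(ClPt Ω × Torus d, ℝ)) : C(ClPt Ω × Torus d × ClUBall E, ℝ) where
  toFun k := (1 - ‖(k.2.2 : E)‖) * φ (k.1, k.2.1)

theorem weighted_apply (φ : C(ClPt Ω × Torus d, ℝ)) (k : ClPt Ω × Torus d × ClUBall E) :
    weighted φ k = (1 - ‖(k.2.2 : E)‖) * φ (k.1, k.2.1) := rfl

/-- Identifies `ofExt (weighted φ)` as the integrand `φ(x, ξ)`, constant in `z`. -/
theorem unscale_weighted (φ : C(ClPt Ω × Torus d, ℝ)) (q : (ClPt Ω × Torus d) × E) :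
    unscale (weighted φ) q = φ q.1 := by
  have h0 : 0 < 1 + ‖q.2‖ := by positivity
  have h1 : ‖(toClUBall q.2 : E)‖ = (1 + ‖q.2‖)⁻¹ * ‖q.2‖ := by
    change ‖(1 + ‖q.2‖)⁻¹ • q.2‖ = _
    rw [norm_smul, Real.norm_of_nonneg (by positivity)]
  rw [unscale, weighted_apply, h1, ← mul_assoc]
  have : (1 + ‖q.2‖) * (1 - (1 + ‖q.2‖)⁻¹ * ‖q.2‖) = 1 := by
    field_simp
    ring
  rw [this, one_mul]

/-- The inclusion of `(cl Ω × Z) × ∂𝔹_E` in `cl Ω × Z × cl 𝔹_E`. -/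
def inclSphere (q : (ClPt Ω × Torus d) × USphere E) : ClPt Ω × Torus d × ClUBall E :=
  (q.1.1, q.1.2, ⟨q.2, Metric.sphere_subset_closedBall q.2.2⟩)

theorem continuous_inclSphere : Continuous (inclSphere (Ω := Ω) (E := E)) := by
  have : Continuous fun z : USphere E =>
      (⟨z, Metric.sphere_subset_closedBall z.2⟩ : ClUBall E) :=
    continuous_inclusion Metric.sphere_subset_closedBall
  unfold inclSphere
  fun_prop

theorem inclSphere_injective : Function.Injective (inclSphere (Ω := Ω) (E := E)) := by
  rintro ⟨⟨x, ξ⟩, z⟩ ⟨⟨x', ξ'⟩, z'⟩ h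
  simp only [inclSphere, Prod.mk.injEq, Subtype.mk.injEq] at h
  obtain ⟨rfl, rfl, h⟩ := h
  rw [Subtype.ext h]

theorem range_inclSphere : range (inclSphere (Ω := Ω) (E := E)) =
    {k | ‖(k.2.2 : E)‖ < 1}ᶜ := by
  ext ⟨x, ξ, z⟩
  have hz : ‖(z : E)‖ ≤ 1 := mem_closedBall_zero_iff.1 z.2
  constructor
  · rintro ⟨q, hq⟩
    rw [← hq]
    simp [inclSphere]
  · intro h
    refine ⟨((x, ξ), ⟨z, ?_⟩), rfl⟩
    rw [mem_sphere_zero_iff_norm]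
    exact le_antisymm hz (not_lt.1 h)

theorem Integrand.recession_eq_inclSphere (f : Integrand Ω E) [FiniteDimensional ℝ E]
    (p : ClPt Ω × Torus d) (z : USphere E) :
    f.recession p.1 p.2 z = f.ext (inclSphere (p, z)) := f.recession_eq _ _ _

/-! ### Splitting a measure into oscillation and concentration -/

variable [FiniteDimensional ℝ E] [MeasurableSpace E] [BorelSpace E]

theorem measurableEmbedding_inclSphere : MeasurableEmbedding (inclSphere (Ω := Ω) (E := E)) :=
  (continuous_inclSphere.isClosedEmbedding inclSphere_injective).measurableEmbedding

/-- The projection of the weighted part of a measure on `cl Ω × Z × 𝔹_E` to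
`(cl Ω × Z) × E`. -/
def oscPart (μ : Measure (ClPt Ω × Torus d × ClUBall E)) : Measure ((ClPt Ω × Torus d) × E) :=
  (μ.withDensity fun k => ENNReal.ofReal (1 - ‖(k.2.2 : E)‖)).map
    fun k => ((k.1, k.2.1), (1 - ‖(k.2.2 : E)‖)⁻¹ • (k.2.2 : E))

/-- The part of a measure on `cl Ω × Z × cl 𝔹_E` that lives on the sphere. -/
def concPart (μ : Measure (ClPt Ω × Torus d × ClUBall E)) :
    Measure ((ClPt Ω × Torus d) × USphere E) := μ.comap inclSphere

section Parts

variable (μ : Measure (ClPt Ω × Torus d × ClUBall E))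

theorem measurable_weight :
    Measurable fun k : ClPt Ω × Torus d × ClUBall E => ENNReal.ofReal (1 - ‖(k.2.2 : E)‖) := by
  fun_prop

theorem measurable_rescale : Measurable fun k : ClPt Ω × Torus d × ClUBall E =>
    ((k.1, k.2.1), (1 - ‖(k.2.2 : E)‖)⁻¹ • (k.2.2 : E)) := by
  fun_prop

/-- Inside the ball the weight cancels the growth factor and leaves `g`. On the sphere the weight
vanishes, so the default value `0⁻¹ = 0` in the rescaling has no effect. -/
theorem toReal_weight_smul_unscale (g : C(ClPt Ω × Torus d × ClUBall E, ℝ)) :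
    (fun k : ClPt Ω × Torus d × ClUBall E => (ENNReal.ofReal (1 - ‖(k.2.2 : E)‖)).toReal •
      unscale g ((k.1, k.2.1), (1 - ‖(k.2.2 : E)‖)⁻¹ • (k.2.2 : E)))
    = {k | ‖(k.2.2 : E)‖ < 1}.indicator g := by
  funext ⟨x, ξ, z⟩
  have hz : ‖(z : E)‖ ≤ 1 := mem_closedBall_zero_iff.1 z.2
  rw [ENNReal.toReal_ofReal (sub_nonneg.2 hz), smul_eq_mul]
  by_cases h : ‖(z : E)‖ < 1
  · rw [unscale_inv_smul g x ξ z h, indicator_of_mem (by exact h)]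
  · rw [indicator_of_notMem (by exact h), le_antisymm hz (not_lt.1 h)]
    simp

theorem measurableSet_norm_lt_one :
    MeasurableSet {k : ClPt Ω × Torus d × ClUBall E | ‖(k.2.2 : E)‖ < 1} :=
  measurableSet_lt (by fun_prop) measurable_const

variable [IsFiniteMeasure μ]

theorem integrable_continuousMap (g : C(ClPt Ω × Torus d × ClUBall E, ℝ)) : Integrable g μ :=
  Integrable.of_bound g.continuous.aestronglyMeasurable ‖g‖
    (Eventually.of_forall g.norm_coe_le_norm)

theorem integrable_unscale_oscPart (g : C(ClPt Ω × Torus d × ClUBall E, ℝ)) :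
    Integrable (unscale g) (oscPart μ) := by
  rw [oscPart, integrable_map_measure (continuous_unscale g).aestronglyMeasurable
    measurable_rescale.aemeasurable, integrable_withDensity_iff_integrable_smul'
    measurable_weight (Eventually.of_forall fun _ => ENNReal.ofReal_lt_top)]
  refine Integrable.congr ((integrable_continuousMap μ g).indicator measurableSet_norm_lt_one) ?_
  rw [← toReal_weight_smul_unscale]
  rfl

theorem integral_unscale_oscPart (g : C(ClPt Ω × Torus d × ClUBall E, ℝ)) :
    ∫ q, unscale g q ∂(oscPart μ) = ∫ k in {k | ‖(k.2.2 : E)‖ < 1}, g k ∂μ := by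
  rw [oscPart, integral_map measurable_rescale.aemeasurable
    (continuous_unscale g).aestronglyMeasurable,
    integral_withDensity_eq_integral_toReal_smul measurable_weight
    (Eventually.of_forall fun _ => ENNReal.ofReal_lt_top), toReal_weight_smul_unscale,
    integral_indicator measurableSet_norm_lt_one]

theorem integral_concPart (g : C(ClPt Ω × Torus d × ClUBall E, ℝ)) :
    ∫ q, g (inclSphere q) ∂(concPart μ) = ∫ k in {k | ‖(k.2.2 : E)‖ < 1}ᶜ, g k ∂μ := by
  rw [concPart, ← measurableEmbedding_inclSphere.integral_map,
    measurableEmbedding_inclSphere.map_comap, range_inclSphere]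

instance : IsFiniteMeasure (oscPart μ) := by
  have : IsFiniteMeasure (μ.withDensity fun k => ENNReal.ofReal (1 - ‖(k.2.2 : E)‖)) := by
    refine isFiniteMeasure_withDensity_ofReal ?_
    refine (Integrable.of_bound (C := 1) (by fun_prop) (Eventually.of_forall fun k => ?_)).2
    have hz : ‖(k.2.2 : E)‖ ≤ 1 := mem_closedBall_zero_iff.1 k.2.2.2
    rw [Real.norm_of_nonneg (sub_nonneg.2 hz)]
    linarith [norm_nonneg (k.2.2 : E)]
  unfold oscPart
  infer_instance

instance : IsFiniteMeasure (concPart μ) := by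
  refine ⟨?_⟩
  rw [concPart, measurableEmbedding_inclSphere.comap_apply]
  exact measure_lt_top _ _

/-- Finite measures are determined by integrals of continuous functions. Testing the marginal with
`φ` means integrating `weighted φ` against `μ`, because `unscale (weighted φ)` is `φ`. -/
theorem oscPart_fst (h : ∀ φ : C(ClPt Ω × Torus d, ℝ),
      ∫ k, weighted φ k ∂μ = ∫ p, φ p ∂((lebCl Ω).prod volume)) :
    (oscPart μ).fst = (lebCl Ω).prod volume := by
  refine ext_of_forall_integral_eq_of_IsFiniteMeasure fun φ => ?_
  rw [← BoundedContinuousFunction.coe_toContinuousMap, ← h, Measure.fst,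
    integral_map measurable_fst.aemeasurable (ContinuousMap.continuous _).aestronglyMeasurable]
  have h1 := integral_unscale_oscPart μ (weighted φ.toContinuousMap)
  simp_rw [unscale_weighted] at h1
  rw [h1]
  -- Extending the integral from the open ball to all of the compact space costs nothing: `weighted
  -- φ` vanishes on the sphere.
  refine setIntegral_eq_integral_of_forall_compl_eq_zero fun k hk => ?_
  have hz : ‖(k.2.2 : E)‖ ≤ 1 := mem_closedBall_zero_iff.1 k.2.2.2
  rw [weighted_apply, le_antisymm hz (not_lt.1 hk), sub_self, zero_mul]

end Parts

theorem YoungMeasure.osc_eq (nu : YoungMeasure Ω E) (f : Integrand Ω E) :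
    ∫ x, ∫ ξ, ∫ z, f (x, ξ, z) ∂(nu.ν (incl Ω x, ξ) : Measure E) ∂volume ∂leb Ω =
    ∫ p, ∫ z, unscale f.ext (p, z) ∂(nu.ν p : Measure E) ∂((lebCl Ω).prod volume) := by
  rw [← integral_prod _ (nu.integrable_osc f), ← integral_comp_incl_prod]
  simp_rw [f.apply_eq_unscale]

/-- A finite measure on `cl Ω × Z × cl 𝔹_E` whose weighted projection is the Lebesgue measure
comes from a two-scale* Young measure. -/
theorem exists_youngMeasure [Nonempty (USphere E)] (μ : Measure (ClPt Ω × Torus d × ClUBall E))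
    [IsFiniteMeasure μ] (h : ∀ φ : C(ClPt Ω × Torus d, ℝ),
      ∫ k, weighted φ k ∂μ = ∫ p, φ p ∂((lebCl Ω).prod volume)) :
    ∃ nu : YoungMeasure Ω E, ∀ f : Integrand Ω E, YoungMeasure.pairing f nu = ∫ k, f.ext k ∂μ := by
  have hfst := oscPart_fst μ h
  let ρ : ClPt Ω → ProbabilityMeasure (Torus d) :=
    fun x => ⟨(concPart μ).fst.condKernel x, inferInstance⟩
  -- The product of `λ` and `ρ` recovers the marginal of `concPart μ` on `cl Ω × Z`, the measure
  -- over which `ν^∞` is disintegrated.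
  have hs : semiProd (concPart μ).fst.fst ρ = (concPart μ).fst := by
    rw [semiProd_congr_kernel (κ := ρ) (η := (concPart μ).fst.condKernel)
      (Eventually.of_forall fun _ => rfl), Measure.disintegrate]
  let nu : YoungMeasure Ω E :=
    { ν := fun p => ⟨(oscPart μ).condKernel p, inferInstance⟩
      lam := (concPart μ).fst.fst
      ρ := ρ
      νInf := fun p => ⟨(concPart μ).condKernel p, inferInstance⟩
      measurable_ν := fun B hB => (Kernel.measurable_coe _ hB).aemeasurable
      integrable_ν := by
        rw [← hfst]
        change ∫⁻ p, ∫⁻ z, ‖z‖ₑ ∂((oscPart μ).condKernel p) ∂(oscPart μ).fst < ∞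
        rw [Measure.lintegral_condKernel (f := fun q => ‖q.2‖ₑ) (by fun_prop)]
        -- The constant function `1` unscales to `1 + |z|`, which is integrable for `oscPart μ` and
        -- dominates `|z|`.
        refine (lintegral_mono fun q => ?_).trans_lt (integrable_unscale_oscPart μ 1).2
        rw [enorm_le_iff_norm_le]
        simp only [unscale, ContinuousMap.one_apply, mul_one]
        rw [Real.norm_of_nonneg (by positivity)]
        linarith
      isFiniteMeasure_lam := inferInstance
      measurable_ρ := fun B hB => (Kernel.measurable_coe _ hB).aemeasurable
      measurable_νInf := fun B hB => (Kernel.measurable_coe _ hB).aemeasurable }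
  refine ⟨nu, fun f => ?_⟩
  have h1 : ∫ p, ∫ z, unscale f.ext (p, z) ∂(nu.ν p : Measure E) ∂((lebCl Ω).prod volume)
      = ∫ k in {k | ‖(k.2.2 : E)‖ < 1}, f.ext k ∂μ := by
    rw [← hfst, ← integral_unscale_oscPart]
    exact Measure.integral_condKernel (integrable_unscale_oscPart μ f.ext)
  have h2 : ∫ p, ∫ z : USphere E, f.recession p.1 p.2 z ∂(nu.νInf p : Measure (USphere E))
      ∂(semiProd nu.lam nu.ρ) = ∫ k in {k | ‖(k.2.2 : E)‖ < 1}ᶜ, f.ext k ∂μ := by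
    simp_rw [f.recession_eq_inclSphere]
    rw [← integral_concPart]
    refine (congrArg (fun m => ∫ p, ∫ z : USphere E, f.ext (inclSphere (p, z))
      ∂(nu.νInf p : Measure (USphere E)) ∂m) hs).trans ?_
    refine Measure.integral_condKernel (f := fun q => f.ext (inclSphere q)) ?_
    exact Integrable.of_bound
      (f.ext.continuous.comp continuous_inclSphere).aestronglyMeasurable ‖f.ext‖
      (Eventually.of_forall fun q => f.ext.norm_coe_le_norm _)
  rw [YoungMeasure.pairing, nu.osc_eq, nu.conc_eq, h1, h2,
    integral_add_compl measurableSet_norm_lt_one (integrable_continuousMap μ f.ext)]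

/-! ### Characterization and weak-* closedness of the set of Young measures -/

namespace YoungMeasure

/-- Both terms of the pairing integrate values of `f.ext`, multiplied by `1 + |z|` in the first and
unweighted on the sphere in the second. -/
theorem pairing_nonneg (nu : YoungMeasure Ω E) (f : Integrand Ω E) (hf : 0 ≤ f.ext) :
    0 ≤ pairing f nu := by
  rw [pairing, nu.osc_eq, nu.conc_eq]
  refine add_nonneg (integral_nonneg fun p => integral_nonneg fun z => ?_)
    (integral_nonneg fun p => integral_nonneg fun z => ?_)
  · exact mul_nonneg (by positivity) (hf _)
  · simp only [f.recession_eq_inclSphere]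
    exact hf _

theorem pairing_weighted (nu : YoungMeasure Ω E) (φ : C(ClPt Ω × Torus d, ℝ)) :
    pairing (Integrand.ofExt (weighted φ)) nu = ∫ p, φ p ∂((lebCl Ω).prod volume) := by
  have h : ∀ q : (ClPt Ω × Torus d) × USphere E,
      weighted (E := E) φ (inclSphere q) = 0 := fun q => by
    simp [weighted_apply, inclSphere]
  rw [pairing, nu.osc_eq, nu.conc_eq]
  simp_rw [Integrand.recession_eq_inclSphere, Integrand.ext_ofExt, unscale_weighted, h]
  simp

theorem norm_toDual_le (nu : YoungMeasure Ω E) :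
    ‖WeakDual.toStrongDual nu.toDual‖ ≤ nu.mass.toReal := by
  refine ContinuousLinearMap.opNorm_le_bound _ ENNReal.toReal_nonneg fun f => ?_
  have h := ENNReal.toReal_mono (ENNReal.mul_ne_top enorm_ne_top nu.mass_lt_top.ne)
    (nu.enorm_pairing_le f)
  rwa [ENNReal.toReal_mul, toReal_enorm, toReal_enorm, mul_comm] at h

end YoungMeasure

variable (Ω E) in
/-- The two-scale* Young measures are the positive functionals whose restriction to the
integrands that are independent of `z` is the integration over `cl Ω × Z`. -/
theorem youngMeasures_eq (h : (youngMeasures Ω E).Nonempty) : youngMeasures Ω E =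
    {L | (∀ f : Integrand Ω E, 0 ≤ f.ext → 0 ≤ L f) ∧ ∀ φ : C(ClPt Ω × Torus d, ℝ),
      L (Integrand.ofExt (weighted φ)) = ∫ p, φ p ∂((lebCl Ω).prod volume)} := by
  refine Subset.antisymm ?_ ?_
  · rintro _ ⟨nu, rfl⟩
    exact ⟨nu.pairing_nonneg, nu.pairing_weighted⟩
  · rintro L ⟨hL, hL'⟩
    obtain ⟨_, nu₀, rfl⟩ := h
    -- Disintegration of the sphere part requires a nonempty sphere, which fails for `E = 0`. If
    -- there is a point `p` of `cl Ω × Z`, the given `nu₀` carries a probability measure on the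
    -- sphere at `p`, so the sphere is nonempty. If there is none, every integrand is zero and all
    -- functionals agree.
    rcases isEmpty_or_nonempty (ClPt Ω × Torus d) with he | ⟨⟨p⟩⟩
    · have hsub : ∀ f : Integrand Ω E, f = 0 := fun f =>
        Subtype.ext <| funext fun q => (he.false (incl Ω q.1, q.2.1)).elim
      refine ⟨nu₀, DFunLike.ext _ _ fun f => ?_⟩
      rw [hsub f, map_zero, map_zero]
    · have : Nonempty (USphere E) := (nu₀.νInf p).nonempty
      obtain ⟨μ, hμ, hμL⟩ := exists_measure_integral_eq_of_nonneg
        (L.toLinearMap ∘ₗ Integrand.ofExt) fun g hg => hL _ (by simpa using hg)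
      obtain ⟨nu, hnu⟩ := exists_youngMeasure μ fun φ => (hμL _).trans (hL' φ)
      refine ⟨nu, DFunLike.ext _ _ fun f => ?_⟩
      rw [YoungMeasure.toDual_apply, hnu, hμL]
      exact congrArg L f.ofExt_ext

variable (Ω E) in
theorem isClosed_youngMeasures : IsClosed (youngMeasures Ω E) := by
  -- For `E = 0` and `Ω` nonempty there are no Young measures, since the empty sphere carries no
  -- probability measure.
  rcases (youngMeasures Ω E).eq_empty_or_nonempty with h | h
  · rw [h]
    exact isClosed_empty
  · rw [youngMeasures_eq Ω E h]
    rw [ofPred_and, ofPred_forall, ofPred_forall]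
    refine IsClosed.inter (isClosed_iInter fun f => ?_) (isClosed_iInter fun φ =>
      isClosed_eq (WeakDual.eval_continuous _) continuous_const)
    rw [ofPred_forall]
    exact isClosed_iInter fun _ => isClosed_le continuous_const (WeakDual.eval_continuous f)

end TwoScale

end
-- The compactness proposition
theorem proposition3p4 {d : ℕ} (Ω : TwoScale.Domain d)
    (E : Type*) [NormedAddCommGroup E] [InnerProductSpace ℝ E] [FiniteDimensional ℝ E]
    [MeasurableSpace E] [BorelSpace E] :
    -- `𝐘²(Ω; E)` is sequentially weak-* closed in `𝐄²(Ω; E)*`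
    IsSeqClosed (TwoScale.youngMeasures Ω E) ∧
    -- bounded subsets are precompact for the relative weak-* topology, also sequentially
    ∀ Y : Set (TwoScale.YoungMeasure Ω E), (⨆ nu ∈ Y, nu.mass) < ∞ →
      IsCompact (closure {L : TwoScale.youngMeasures Ω E | ∃ nu ∈ Y, nu.toDual = L}) ∧
      ∀ s : ℕ → TwoScale.YoungMeasure Ω E, (∀ n, s n ∈ Y) →
        ∃ (nu : TwoScale.YoungMeasure Ω E) (k : ℕ → ℕ), StrictMono k ∧
          Tendsto (fun n => (s (k n)).toDual) atTop (𝓝 nu.toDual) := by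
  have hcl := TwoScale.isClosed_youngMeasures Ω E
  refine ⟨hcl.isSeqClosed, fun Y hY => ?_⟩
  set B : Set (WeakDual ℝ (TwoScale.Integrand Ω E)) :=
    WeakDual.toStrongDual ⁻¹' Metric.closedBall 0 (⨆ nu ∈ Y, nu.mass).toReal
  have hB : ∀ nu ∈ Y, nu.toDual ∈ B := fun nu hnu => by
    refine mem_closedBall_zero_iff.2 (nu.norm_toDual_le.trans ?_)
    -- Finiteness of the supremum is essential here, as `toReal` sends `∞` to `0`.
    exact ENNReal.toReal_mono hY.ne (le_biSup TwoScale.YoungMeasure.mass hnu)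
  constructor
  -- As `𝐘²` is closed, its inclusion in the dual is a closed embedding, so the Banach–Alaoglu ball
  -- meets it in a set that is compact for the relative topology. The closure taken inside `𝐘²`
  -- stays in that set because the ball is weak-* closed.
  · have hc : IsCompact ((↑) ⁻¹' B : Set (TwoScale.youngMeasures Ω E)) :=
      hcl.isClosedEmbedding_subtypeVal.isCompact_preimage (WeakDual.isCompact_closedBall 0 _)
    refine hc.of_isClosed_subset isClosed_closure (closure_minimal ?_
      ((WeakDual.isClosed_closedBall 0 _).preimage continuous_subtype_val))
    rintro L ⟨nu, hnu, h⟩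
    rw [mem_preimage, ← h]
    exact hB nu hnu
  · intro s hs
    obtain ⟨L, -, k, hk, hL⟩ := WeakDual.isSeqCompact_closedBall ℝ (TwoScale.Integrand Ω E) 0
      (⨆ nu ∈ Y, nu.mass).toReal fun n => hB (s n) (hs n)
    -- The subsequential limit is a priori only a functional; closedness of `𝐘²` makes it a Young
    -- measure.
    obtain ⟨nu, rfl⟩ := hcl.mem_of_tendsto hL (Eventually.of_forall fun n => ⟨s (k n), rfl⟩)
    exact ⟨nu, k, hk, hL⟩
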